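/- Let $\mathbf x_C\in\mathbb R^3$ and let $c_i$ ($i\in\mathbb N_0^3$, $|i|=i_1+i_2+i_3\le 2$) be complex-valued functions that are $\mathcal C^\infty$ at $\mathbf x_C$, with $c_{2e_1}(\mathbf x_C)\neq 0$ and such that the symmetric $3\times 3$ matrix $\mathcal C$ with entries $\mathcal C_{kk}=c_{2e_k}(\mathbf x_C)$ and $\mathcal C_{kk'}=\tfrac12 c_{e_k+e_{k'}}(\mathbf x_C)$ for $k\ne k'$ is non-singular. Let $\mathcal C=\mathcal P\mathcal D\mathcal P^T$ with $\mathcal P$ real orthogonal and $\mathcal D$ real, diagonal and non-singular, let $\mathcal D^{-1/2}$ be formed with principal complex square roots, and let $\mathfrak s\in\mathbb C\setminus\{0\}$. Let $n\in\mathbb N_0$. Let $\theta_0,\dots,\theta_n\in(0,\pi)$ be pairwise distinct, and let $\varphi_{lm}\in[0,2\pi)$, for $0\le l\le n$ and $m\in\mathbb Z$ with $|m|\le l$, satisfy $\varphi_{lm}\ne\varphi_{lm'}$ whenever $m\ne m'$. These give $(n+1)^2$ directions $$\mathbf d_{l,m}=(\sin\theta_l\cos\varphi_{lm},\ \sin\theta_l\sin\varphi_{lm},\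 \cos\theta_l),$$ and functions $\chi_{l,m}(x)=\exp\big(\mathfrak s\,\mathcal P\mathcal D^{-1/2}\mathbf d_{l,m}\cdot(x-\mathbf x_C)\big)$, where $\cdot$ is the bilinear dot product. Let $\mathsf R^{[n]}$ and $\mathsf E^{[n]}$ be the complex matrices with $\frac{(n+1)(n+2)(n+3)}6$ rows, indexed by the $i\in\mathbb N_0^3$ with $|i|\le n$, and $(n+1)^2$ columns, indexed by the pairs $(l,m)$, with entries $$\mathsf R^{[n]}_{i,(l,m)}=\frac{(\sin\varphi_{lm})^{i_1}(\cos\varphi_{lm})^{i_2}(\sin\theta_l)^{i_1+i_2}(\cos\theta_l)^{i_3}}{i!},\qquad \mathsf E^{[n]}_{i,(l,m)}=\frac{1}{i!}\,\partial_x^i\chi_{l,m}(\mathbf x_C).$$ Then $\mathsf R^{[n]}$ and $\mathsf E^{[n]}$ have rank $(n+1)^2$. Moreover, the submatrices $\overline{\mathsf R}^{[n]}$ and $\overline{\mathsf E}^{[n]}$ obtained from them by removing all rows $i$ with $i_1>1$ are square, of size $(n+1)^2$, and also have rank $(n+1)^2$. The statements about $\mathsf E^{[n]}$ and $\overline{\mathsf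 E}^{[n]}$ hold as well if instead $\mathbf d_{l,m}=(\sin\theta_l\sin\varphi_{lm},\sin\theta_l\cos\varphi_{lm},\cos\theta_l)$ for all $(l,m)$. -/

import Mathlib

noncomputable section

namespace QT

/-- Physical space `ℝ³`. -/
abbrev E3 : Type := EuclideanSpace ℝ (Fin 3)

/-- Multi-indices `(i₁, i₂, i₃)`; the component `i₁` is `i 0`. -/
abbrev MIdx : Type := Fin 3 → ℕ

/-- The length `|i| = i₁ + i₂ + i₃`. -/
def MIdx.len (i : MIdx) : ℕ := ∑ k, i k

/-- The factorial `i! = i₁! i₂! i₃!`. -/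
def MIdx.fact (i : MIdx) : ℕ := ∏ k, (i k).factorial

/-- The first order partial derivative `∂f/∂x_k` of a complex-valued function on `ℝ³`. -/
def pderiv (k : Fin 3) (f : E3 → ℂ) : E3 → ℂ :=
  fun x => lineDeriv ℝ f x (EuclideanSpace.single k 1)

/-- `∂^i f = ∂₁^{i₁} ∂₂^{i₂} ∂₃^{i₃} f`. -/
def mderiv (i : MIdx) (f : E3 → ℂ) : E3 → ℂ :=
  (pderiv 0)^[i 0] ((pderiv 1)^[i 1] ((pderiv 2)^[i 2] f))

/-- The Taylor coefficient `T_f[i] = ∂^i f(x_C) / i!` at the point `x_C`. -/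
def taylorCoeff (xC : E3) (f : E3 → ℂ) (i : MIdx) : ℂ :=
  mderiv i f xC / (i.fact : ℂ)

/-- The symmetric matrix of the second order coefficients at `x_C` of
`∑_{|i| ≤ 2} c_i(x) ∂^i`: its diagonal entries are `c_{2e_k}(x_C)`, its off-diagonal entries
are `c_{e_k+e_l}(x_C) / 2`. -/
def secondOrderMatrix (c : MIdx → E3 → ℂ) (xC : E3) : Matrix (Fin 3) (Fin 3) ℂ :=
  Matrix.of fun k l =>
    if k = l then c (Pi.single k 2) xC
    else (1 / 2 : ℂ) * c (Pi.single k 1 + Pi.single l 1) xC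

/-- The standing hypothesis on the coefficients `c_i`, `|i| ≤ 2`, of the operator at `x_C`.
The values of `c` at multi-indices of length greater than two play no role. -/
structure OperatorHyp (c : MIdx → E3 → ℂ) (xC : E3) : Prop where
  smooth : ∀ i : MIdx, i.len ≤ 2 → ContDiffAt ℝ ((⊤ : ℕ∞) : WithTop ℕ∞) (c i) xC
  ne_zero : c (Pi.single 0 2) xC ≠ 0
  nonsing : IsUnit (secondOrderMatrix c xC).det

/-- `P` (real orthogonal) and `D = diag(δ)` (real, non-singular) satisfy `C = P D Pᵀ`. -/
structure IsOrthDiag (C : Matrix (Fin 3) (Fin 3) ℂ) (P : Matrix (Fin 3) (Fin 3) ℝ)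
    (δ : Fin 3 → ℝ) : Prop where
  orth : P ∈ Matrix.orthogonalGroup (Fin 3) ℝ
  ne_zero : ∀ k, δ k ≠ 0
  eq : C = (P * Matrix.diagonal δ * P.transpose).map (fun t : ℝ => (t : ℂ))

/-- The matrix `P D^{-1/2}` for `D = diag(δ)`; the square roots are principal complex ones, since
entries of `D` may be negative. -/
def scaledFrame (P : Matrix (Fin 3) (Fin 3) ℝ) (δ : Fin 3 → ℝ) : Matrix (Fin 3) (Fin 3) ℂ :=
  P.map (fun t : ℝ => (t : ℂ)) * Matrix.diagonal fun k => ((δ k : ℂ) ^ (-(1 / 2) : ℂ))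

/-- The exponential `χ(x) = exp(s P D^{-1/2} d · (x - x_C))`, the dot being the bilinear one. -/
def planeWave (s : ℂ) (P : Matrix (Fin 3) (Fin 3) ℝ) (δ : Fin 3 → ℝ) (xC : E3)
    (d : Fin 3 → ℝ) : E3 → ℂ :=
  fun x => Complex.exp
    (∑ k, s * (scaledFrame P δ).mulVec (fun j => (d j : ℂ)) k * ((x k - xC k : ℝ) : ℂ))

/-- The direction `(sin θ cos φ, sin θ sin φ, cos θ)`. -/
def direction (θ φ : ℝ) : Fin 3 → ℝ :=
  ![Real.sin θ * Real.cos φ, Real.sin θ * Real.sin φ, Real.cos θ]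

/-- The same parametrization with the first two coordinates interchanged,
`(sin θ sin φ, sin θ cos φ, cos θ)`. -/
def directionSwap (θ φ : ℝ) : Fin 3 → ℝ :=
  ![Real.sin θ * Real.sin φ, Real.sin θ * Real.cos φ, Real.cos θ]

/-- Row indices: multi-indices of length at most `n`. -/
abbrev Row (n : ℕ) : Type := {i : MIdx // i.len ≤ n}

/-- Row indices that remain once the rows with `i₁ > 1` are removed. -/
abbrev RedRow (n : ℕ) : Type := {i : Row n // i.1 0 ≤ 1}

/-- Column indices: pairs `(l, m)` with `0 ≤ l ≤ n` and `m ∈ ℤ`, `|m| ≤ l`. -/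
abbrev Col (n : ℕ) : Type := (l : Fin (n + 1)) × ↥(Finset.Icc (-(l : ℤ)) (l : ℤ))

/-- The exponential matrix: Taylor coefficients of the functions `χ_{l,m}`. -/
def matE (n : ℕ) (s : ℂ) (P : Matrix (Fin 3) (Fin 3) ℝ) (δ : Fin 3 → ℝ) (xC : E3)
    (d : Col n → Fin 3 → ℝ) : Matrix (Row n) (Col n) ℂ :=
  Matrix.of fun i q => taylorCoeff xC (planeWave s P δ xC (d q)) i.1

/-- The trigonometric reference matrix, with entries
`(sin φ)^{i₁} (cos φ)^{i₂} (sin θ)^{i₁+i₂} (cos θ)^{i₃} / i!`. -/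
def matR (n : ℕ) (θ φ : Col n → ℝ) : Matrix (Row n) (Col n) ℂ :=
  Matrix.of fun i q =>
    ((Real.sin (φ q) ^ i.1 0 * Real.cos (φ q) ^ i.1 1 * Real.sin (θ q) ^ (i.1 0 + i.1 1)
      * Real.cos (θ q) ^ i.1 2 / (i.1.fact : ℝ) : ℝ) : ℂ)

/-- The submatrix obtained by removing all rows `i` with `i₁ > 1`. -/
def reduced {n : ℕ} (M : Matrix (Row n) (Col n) ℂ) : Matrix (RedRow n) (Col n) ℂ :=
  M.submatrix Subtype.val id

end QT

end

/-! The columns are independent already after removing the rows with `i₁ > 1`, so all ranks equal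
the number of columns. The entries are `v^i / i!` at points `v = s P D^{-1/2} d`, which lie on the
quadric `vᵀ C v = s²`. A kernel vector `g` gives a functional `f ↦ ∑ g q * f q` killing the
monomials of degree at most `n` with `i₁ ≤ 1`. As `C₀₀ ≠ 0`, the quadric rewrites `v₀²` in terms of
lower powers of `v₀`, so every polynomial of degree at most `n` is killed (`sum_monomial_eq_zero`),
whether in `v` or, after a linear change, in `d`.

Then `g = 0` by induction on `l` (`eq_zero_of_sum_isPolyFun`). To isolate `(l, m)`, multiply `l`
vertical planes through the other `2l` points of circle `l`, taken in pairs
(`exists_isPolyFun_circle`), by the `n - l` planes `z = cos θ_{l'}` with `l' > l`. This has degree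
`n`; on the circles below `l`, `g` is already zero. -/

namespace QT

/-! ### Polynomial functions of bounded degree on a point set -/

/-- `h` is the restriction of a polynomial of total degree at most `k` to the points `v q`. -/
def IsPolyFun {Q : Type*} (v : Q → Fin 3 → ℂ) (k : ℕ) (h : Q → ℂ) : Prop :=
  ∃ p : MvPolynomial (Fin 3) ℂ, p.totalDegree ≤ k ∧ ∀ q, MvPolynomial.eval (v q) p = h q

namespace IsPolyFun

variable {Q : Type*} {v : Q → Fin 3 → ℂ} {k l : ℕ} {f h : Q → ℂ}

lemma mono (hkl : k ≤ l) (hf : IsPolyFun v k f) : IsPolyFun v l f := by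
  obtain ⟨p, hp, hpe⟩ := hf
  exact ⟨p, hp.trans hkl, hpe⟩

lemma const (a : ℂ) : IsPolyFun v k (fun _ => a) :=
  ⟨MvPolynomial.C a, by simp, by simp⟩

lemma coord (j : Fin 3) : IsPolyFun v 1 (fun q => v q j) :=
  ⟨MvPolynomial.X j, by simp, by simp⟩

lemma add (hf : IsPolyFun v k f) (hh : IsPolyFun v k h) :
    IsPolyFun v k (fun q => f q + h q) := by
  obtain ⟨p, hp, hpe⟩ := hf
  obtain ⟨r, hr, hre⟩ := hh
  exact ⟨p + r, (MvPolynomial.totalDegree_add p r).trans (max_le hp hr), by simp [hpe, hre]⟩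

lemma mul (hf : IsPolyFun v k f) (hh : IsPolyFun v l h) :
    IsPolyFun v (k + l) (fun q => f q * h q) := by
  obtain ⟨p, hp, hpe⟩ := hf
  obtain ⟨r, hr, hre⟩ := hh
  exact ⟨p * r, (MvPolynomial.totalDegree_mul p r).trans (add_le_add hp hr), by simp [hpe, hre]⟩

lemma const_mul (a : ℂ) (hf : IsPolyFun v k f) : IsPolyFun v k (fun q => a * f q) := by
  simpa using (const (k := 0) a).mul hf

lemma prod {ι : Type*} (s : Finset ι) {F : ι → Q → ℂ} (hF : ∀ i, IsPolyFun v 1 (F i)) :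
    IsPolyFun v s.card (fun q => ∏ i ∈ s, F i q) := by
  classical
  induction s using Finset.induction_on with
  | empty => simpa using const (k := 0) 1
  | insert a s ha ih =>
    rw [Finset.card_insert_of_notMem ha, add_comm]
    simp only [Finset.prod_insert ha]
    exact (hF a).mul ih

lemma linear (a : Fin 3 → ℂ) : IsPolyFun v 1 (fun q => ∑ j, a j * v q j) := by
  simp only [Fin.sum_univ_three]
  exact (((coord 0).const_mul _).add ((coord 1).const_mul _)).add ((coord 2).const_mul _)

/-- A functional `f ↦ ∑ g q * f q` that vanishes on the monomials of degree at most `n` vanishes on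
the polynomial functions of degree at most `n`. -/
lemma sum_eq_zero [Fintype Q] {n : ℕ} {g : Q → ℂ}
    (hg : ∀ i : Fin 3 → ℕ, ∑ k, i k ≤ n → ∑ q, g q * ∏ k, v q k ^ i k = 0)
    (hf : IsPolyFun v n f) : ∑ q, g q * f q = 0 := by
  obtain ⟨p, hp, hpe⟩ := hf
  simp_rw [← hpe, MvPolynomial.eval_eq', Finset.mul_sum]
  rw [Finset.sum_comm]
  refine Finset.sum_eq_zero fun d hd => ?_
  have h := hg d (by
    have := MvPolynomial.le_totalDegree hd
    rw [Finsupp.sum_fintype _ _ (by simp)] at this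
    exact this.trans hp)
  calc ∑ q, g q * (MvPolynomial.coeff d p * ∏ i, v q i ^ d i)
      = MvPolynomial.coeff d p * ∑ q, g q * ∏ i, v q i ^ d i := by
        rw [Finset.mul_sum]; exact Finset.sum_congr rfl fun q _ => by ring
    _ = 0 := by rw [h, mul_zero]

end IsPolyFun

/-! ### Elimination of the first variable on a quadric -/

/-- On a quadric `vᵀ C v = κ` with `C₀₀ ≠ 0`, the monomials of degree at most one in the first
variable determine all the others. -/
lemma sum_monomial_eq_zero {Q : Type*} [Fintype Q] {v : Q → Fin 3 → ℂ}
    {C : Matrix (Fin 3) (Fin 3) ℂ} {κ : ℂ} (hC : C 0 0 ≠ 0)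
    (hquad : ∀ q, v q ⬝ᵥ C.mulVec (v q) = κ) {n : ℕ} {g : Q → ℂ}
    (hg : ∀ i : Fin 3 → ℕ, ∑ k, i k ≤ n → i 0 ≤ 1 → ∑ q, g q * ∏ k, v q k ^ i k = 0)
    (i : Fin 3 → ℕ) (hi : ∑ k, i k ≤ n) : ∑ q, g q * ∏ k, v q k ^ i k = 0 := by
  have key : ∀ a b c : ℕ, a + b + c ≤ n →
      ∑ q, g q * (v q 0 ^ a * v q 1 ^ b * v q 2 ^ c) = 0 := by
    intro a
    induction a using Nat.strong_induction_on with
    | _ a ih =>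
      intro b c h
      rcases Nat.lt_or_ge a 2 with ha | ha
      · have := hg ![a, b, c] (by simpa [Fin.sum_univ_three] using h) (by simp; omega)
        simpa [Fin.prod_univ_three] using this
      · obtain ⟨a, rfl⟩ := Nat.exists_eq_add_of_le' ha
        have h1 := ih a (by omega) b c (by omega)
        have h2 := ih (a + 1) (by omega) (b + 1) c (by omega)
        have h3 := ih (a + 1) (by omega) b (c + 1) (by omega)
        have h4 := ih a (by omega) (b + 2) c (by omega)
        have h5 := ih a (by omega) (b + 1) (c + 1) (by omega)
        have h6 := ih a (by omega) b (c + 2) (by omega)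
        -- The quadric equation times `v₀^a v₁^b v₂^c`, summed against `g` and solved for the `v₀²`
        -- term. The sums on the right have smaller first exponent and no larger degree.
        have : C 0 0 * ∑ q, g q * (v q 0 ^ (a + 2) * v q 1 ^ b * v q 2 ^ c) =
            κ * (∑ q, g q * (v q 0 ^ a * v q 1 ^ b * v q 2 ^ c))
            - (C 0 1 + C 1 0) * (∑ q, g q * (v q 0 ^ (a + 1) * v q 1 ^ (b + 1) * v q 2 ^ c))
            - (C 0 2 + C 2 0) * (∑ q, g q * (v q 0 ^ (a + 1) * v q 1 ^ b * v q 2 ^ (c + 1)))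
            - C 1 1 * (∑ q, g q * (v q 0 ^ a * v q 1 ^ (b + 2) * v q 2 ^ c))
            - (C 1 2 + C 2 1) * (∑ q, g q * (v q 0 ^ a * v q 1 ^ (b + 1) * v q 2 ^ (c + 1)))
            - C 2 2 * (∑ q, g q * (v q 0 ^ a * v q 1 ^ b * v q 2 ^ (c + 2))) := by
          simp only [Finset.mul_sum, ← Finset.sum_sub_distrib]
          refine Finset.sum_congr rfl fun q _ => ?_
          have hq := hquad q
          simp only [dotProduct, Matrix.mulVec, Fin.sum_univ_three] at hq
          rw [← hq]
          ring
        rw [h1, h2, h3, h4, h5, h6] at this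
        simpa [hC] using this
  simpa [Fin.prod_univ_three] using key (i 0) (i 1) (i 2) (by simpa [Fin.sum_univ_three] using hi)

/-! ### Separating polynomials on circles of latitude -/

lemma sin_half_sub_ne_zero {α γ : ℝ} (hα : α ∈ Set.Ico 0 (2 * Real.pi))
    (hγ : γ ∈ Set.Ico 0 (2 * Real.pi)) (h : γ ≠ α) : Real.sin ((γ - α) / 2) ≠ 0 := by
  intro h0
  have := (Real.sin_eq_zero_iff_of_lt_of_lt (by linarith [hα.2, hγ.1]) (by linarith [hα.1, hγ.2])).1 h0
  exact h (by linarith)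

/-- The equation of the chord of the unit circle with end points at the angles `α` and `β`. -/
lemma chord_eq (α β γ : ℝ) :
    Real.cos ((α + β) / 2) * Real.cos γ + Real.sin ((α + β) / 2) * Real.sin γ
      - Real.cos ((α - β) / 2) = -2 * Real.sin ((γ - α) / 2) * Real.sin ((γ - β) / 2) := by
  have h1 : Real.cos ((α + β) / 2) * Real.cos γ + Real.sin ((α + β) / 2) * Real.sin γ
      = Real.cos ((γ - α) / 2 + (γ - β) / 2) := by
    rw [← Real.cos_sub, ← Real.cos_neg]; congr 1; ring
  have h2 : Real.cos ((α - β) / 2) = Real.cos ((γ - β) / 2 - (γ - α) / 2) := by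
    congr 1; ring
  rw [h1, h2, Real.cos_add, Real.cos_sub]
  ring

section Sphere

variable {Q : Type*} {v : Q → Fin 3 → ℂ} {θ φ : Q → ℝ}

/-- A polynomial function of degree `k` which, on the circle of latitude `t`, vanishes at `2k` given
points but not at a further given point. -/
lemma exists_isPolyFun_circle
    (hx : IsPolyFun v 1 (fun q => ((Real.sin (θ q) * Real.cos (φ q) : ℝ) : ℂ)))
    (hy : IsPolyFun v 1 (fun q => ((Real.sin (θ q) * Real.sin (φ q) : ℝ) : ℂ)))
    {t : ℝ} (ht : Real.sin t ≠ 0) {γ : ℝ} (hγ : γ ∈ Set.Ico 0 (2 * Real.pi))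
    (k : ℕ) (S : Finset ℝ) (hS : ∀ α ∈ S, α ∈ Set.Ico 0 (2 * Real.pi)) (hγS : γ ∉ S)
    (hcard : S.card ≤ 2 * k) :
    ∃ h : Q → ℂ, IsPolyFun v k h ∧ ∀ q, θ q = t →
      (φ q ∈ S → h q = 0) ∧ (φ q = γ → h q ≠ 0) := by
  induction k generalizing S with
  | zero =>
    have : S = ∅ := by simpa using hcard
    exact ⟨fun _ => 1, IsPolyFun.const 1, by simp [this]⟩
  | succ k ih =>
    rcases S.eq_empty_or_nonempty with rfl | ⟨α, hα⟩
    · exact ⟨fun _ => 1, IsPolyFun.const 1, by simp⟩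
    -- If `α` is the only point left, `β = α` and the chord becomes a tangent, which still meets the
    -- circle nowhere else.
    obtain ⟨β, hβ, hβc⟩ : ∃ β ∈ S, ((S.erase α).erase β).card ≤ 2 * k := by
      rcases (S.erase α).eq_empty_or_nonempty with h | ⟨β, hβ⟩
      · exact ⟨α, hα, by simp [h]⟩
      · refine ⟨β, Finset.mem_of_mem_erase hβ, ?_⟩
        rw [Finset.card_erase_of_mem hβ, Finset.card_erase_of_mem hα]
        omega
    obtain ⟨h, hh, hq⟩ := ih ((S.erase α).erase β)
      (fun x hx => hS x (Finset.mem_of_mem_erase (Finset.mem_of_mem_erase hx)))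
      (fun hx => hγS (Finset.mem_of_mem_erase (Finset.mem_of_mem_erase hx))) hβc
    refine ⟨_, hh.mul (((hx.const_mul (Real.cos ((α + β) / 2) : ℂ)).add
      (hy.const_mul (Real.sin ((α + β) / 2) : ℂ))).add
      (IsPolyFun.const (-(Real.sin t * Real.cos ((α - β) / 2) : ℝ) : ℂ))), fun q hqt => ?_⟩
    have hline : ((Real.cos ((α + β) / 2) : ℝ) : ℂ) * ((Real.sin (θ q) * Real.cos (φ q) : ℝ) : ℂ)
        + ((Real.sin ((α + β) / 2) : ℝ) : ℂ) * ((Real.sin (θ q) * Real.sin (φ q) : ℝ) : ℂ)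
        + -((Real.sin t * Real.cos ((α - β) / 2) : ℝ) : ℂ)
        = ((Real.sin t * (-2 * Real.sin ((φ q - α) / 2) * Real.sin ((φ q - β) / 2)) : ℝ) : ℂ) := by
      rw [← chord_eq, hqt]
      push_cast
      ring
    rw [hline]
    refine ⟨fun hφ => ?_, fun hφ => ?_⟩
    · by_cases h1 : φ q = α
      · simp [h1]
      by_cases h2 : φ q = β
      · simp [h2]
      rw [((hq q hqt).1 (by simp [h1, h2, hφ])), zero_mul]
    · refine mul_ne_zero ((hq q hqt).2 hφ) ?_
      have h1 := sin_half_sub_ne_zero (hS α hα) hγ (fun h => hγS (h ▸ hα))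
      have h2 := sin_half_sub_ne_zero (hS β hβ) hγ (fun h => hγS (h ▸ hβ))
      rw [hφ]
      exact_mod_cast mul_ne_zero ht (mul_ne_zero (mul_ne_zero (by norm_num) h1) h2)

end Sphere

/-- Functionals supported at the given directions that vanish on polynomials of degree at most `n`
are zero. -/
lemma eq_zero_of_sum_isPolyFun {n : ℕ} {v : Col n → Fin 3 → ℂ}
    {θ : Fin (n + 1) → ℝ} (hθ : ∀ l, θ l ∈ Set.Ioo 0 Real.pi) (hθinj : Function.Injective θ)
    {φ : Col n → ℝ} (hφ : ∀ q, φ q ∈ Set.Ico 0 (2 * Real.pi))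
    (hφinj : ∀ l : Fin (n + 1), ∀ m m' : ↥(Finset.Icc (-(l : ℤ)) (l : ℤ)),
      m ≠ m' → φ ⟨l, m⟩ ≠ φ ⟨l, m'⟩)
    (hx : IsPolyFun v 1 (fun q => ((Real.sin (θ q.1) * Real.cos (φ q) : ℝ) : ℂ)))
    (hy : IsPolyFun v 1 (fun q => ((Real.sin (θ q.1) * Real.sin (φ q) : ℝ) : ℂ)))
    (hz : IsPolyFun v 1 (fun q => ((Real.cos (θ q.1) : ℝ) : ℂ)))
    {g : Col n → ℂ} (hg : ∀ f, IsPolyFun v n f → ∑ q, g q * f q = 0) : g = 0 := by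
  classical
  suffices H : ∀ l : ℕ, ∀ q : Col n, (q.1 : ℕ) = l → g q = 0 from funext fun q => H _ q rfl
  intro l
  induction l using Nat.strong_induction_on with
  | _ l ih =>
    rintro ⟨l, m⟩ rfl
    simp only at ih
    set S : Finset ℝ := (Finset.univ.erase m).image fun m' => φ ⟨l, m'⟩ with hSdef
    have hScard : S.card ≤ 2 * (l : ℕ) := by
      refine Finset.card_image_le.trans ?_
      rw [Finset.card_erase_of_mem (Finset.mem_univ _), Finset.card_univ, Fintype.card_coe,
        Int.card_Icc]
      omega
    have hSmem : ∀ α ∈ S, α ∈ Set.Ico 0 (2 * Real.pi) := by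
      intro α hα
      obtain ⟨m', -, rfl⟩ := Finset.mem_image.1 hα
      exact hφ _
    have hmS : φ ⟨l, m⟩ ∉ S := by
      intro h
      obtain ⟨m', hm', he⟩ := Finset.mem_image.1 h
      exact hφinj l m' m (Finset.ne_of_mem_erase hm') he
    obtain ⟨h, hh, hq⟩ := exists_isPolyFun_circle (θ := fun q : Col n => θ q.1) hx hy
      (Real.sin_pos_of_mem_Ioo (hθ l)).ne' (hφ ⟨l, m⟩) l S hSmem hmS hScard
    have hprod := IsPolyFun.prod (Finset.Ioi l) fun l' : Fin (n + 1) =>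
      hz.add (IsPolyFun.const (-(Real.cos (θ l') : ℂ)))
    -- The degree is `l + (n - l) = n`, the second summand counting the circles above `l`.
    have hsum := hg _ ((hh.mul hprod).mono (by rw [Fin.card_Ioi]; omega))
    rw [Finset.sum_eq_single (⟨l, m⟩ : Col n)] at hsum
    · rcases mul_eq_zero.1 hsum with h0 | h0
      · exact h0
      exfalso
      rcases mul_eq_zero.1 h0 with h0 | h0
      · exact (hq ⟨l, m⟩ rfl).2 rfl h0
      · obtain ⟨l', hl', h0⟩ := Finset.prod_eq_zero_iff.1 h0
        have h1 : Real.cos (θ l) = Real.cos (θ l') := by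
          exact_mod_cast add_neg_eq_zero.1 h0
        have h2 := Real.injOn_cos (Set.Ioo_subset_Icc_self (hθ l))
          (Set.Ioo_subset_Icc_self (hθ l')) h1
        exact (Finset.mem_Ioi.1 hl').ne (hθinj h2)
    · rintro ⟨l', m'⟩ - hne
      rcases lt_trichotomy l' l with hl | rfl | hl
      · rw [ih _ hl ⟨l', m'⟩ rfl, zero_mul]
      · have : m' ≠ m := fun h => hne (by rw [h])
        rw [(hq ⟨l', m'⟩ rfl).1 (Finset.mem_image_of_mem _ (by simp [this]))]
        simp
      · rw [Finset.prod_eq_zero (Finset.mem_Ioi.2 hl) (by simp)]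
        simp
    · simp

/-! ### From trivial kernel to rank -/

/-- The matrix of scaled monomials `v^i / i!` of degree at most one in the first variable. -/
lemma rank_reduced_monomial {n : ℕ} {v : Col n → Fin 3 → ℂ}
    {C : Matrix (Fin 3) (Fin 3) ℂ} {κ : ℂ} (hC : C 0 0 ≠ 0)
    (hquad : ∀ q, v q ⬝ᵥ C.mulVec (v q) = κ)
    {θ : Fin (n + 1) → ℝ} (hθ : ∀ l, θ l ∈ Set.Ioo 0 Real.pi) (hθinj : Function.Injective θ)
    {φ : Col n → ℝ} (hφ : ∀ q, φ q ∈ Set.Ico 0 (2 * Real.pi))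
    (hφinj : ∀ l : Fin (n + 1), ∀ m m' : ↥(Finset.Icc (-(l : ℤ)) (l : ℤ)),
      m ≠ m' → φ ⟨l, m⟩ ≠ φ ⟨l, m'⟩)
    (hx : IsPolyFun v 1 (fun q => ((Real.sin (θ q.1) * Real.cos (φ q) : ℝ) : ℂ)))
    (hy : IsPolyFun v 1 (fun q => ((Real.sin (θ q.1) * Real.sin (φ q) : ℝ) : ℂ)))
    (hz : IsPolyFun v 1 (fun q => ((Real.cos (θ q.1) : ℝ) : ℂ)))
    {A : Matrix (Row n) (Col n) ℂ}
    (hA : ∀ i q, A i q = (∏ k, v q k ^ i.1 k) / (i.1.fact : ℂ)) :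
    (reduced A).rank = Fintype.card (Col n) ∧ A.rank = Fintype.card (Col n) := by
  have hker : ∀ g : Col n → ℂ, (reduced A).mulVec g = 0 → g = 0 := by
    intro g hg
    refine eq_zero_of_sum_isPolyFun hθ hθinj hφ hφinj hx hy hz fun f hf =>
      hf.sum_eq_zero (sum_monomial_eq_zero hC hquad fun i hi hi0 => ?_)
    have h := congrFun hg ⟨⟨i, hi⟩, hi0⟩
    have hfact : (MIdx.fact i : ℂ) ≠ 0 :=
      Nat.cast_ne_zero.2 (Finset.prod_ne_zero_iff.2 fun k _ => Nat.factorial_ne_zero _)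
    simp only [Matrix.mulVec, dotProduct, reduced, Matrix.submatrix_apply, id, hA,
      Pi.zero_apply] at h
    calc ∑ q, g q * ∏ k, v q k ^ i k
        = (MIdx.fact i : ℂ) * ∑ q, (∏ k, v q k ^ i k) / (MIdx.fact i : ℂ) * g q := by
          rw [Finset.mul_sum]
          exact Finset.sum_congr rfl fun q _ => by field_simp
      _ = 0 := by rw [h, mul_zero]
  have hrank : ∀ {R : Type} (B : Matrix R (Col n) ℂ), (∀ g, B.mulVec g = 0 → g = 0) →
      B.rank = Fintype.card (Col n) := by
    intro R B hB
    rw [Matrix.rank, LinearMap.finrank_range_of_inj, Module.finrank_fintype_fun_eq_card]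
    exact (injective_iff_map_eq_zero _).2 fun g hg => hB g (by simpa using hg)
  -- The rows of the reduced matrix are rows of `A`, so the kernel of `A` is contained in the
  -- reduced one.
  refine ⟨hrank _ hker, hrank _ fun g hg => hker g (funext fun i => ?_)⟩
  exact congrFun hg i.1


/-! ### Taylor coefficients of exponentials -/

/-- The factor `b` makes the family stable under differentiation, so that the formula can be
iterated. -/
lemma pderiv_const_mul_exp (a : Fin 3 → ℂ) (xC : E3) (b : ℂ) (k : Fin 3) :
    pderiv k (fun x : E3 => b * Complex.exp (∑ j, a j * ((x j - xC j : ℝ) : ℂ))) =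
      fun x : E3 => (a k * b) * Complex.exp (∑ j, a j * ((x j - xC j : ℝ) : ℂ)) := by
  funext x
  refine HasLineDerivAt.lineDeriv ?_
  unfold HasLineDerivAt
  have hlin : ∀ t : ℝ, (∑ j, a j * (((x + t • EuclideanSpace.single k (1 : ℝ)) j - xC j : ℝ) : ℂ))
      = (∑ j, a j * ((x j - xC j : ℝ) : ℂ)) + a k * (t : ℂ) := by
    intro t
    have : ∀ j, a j * (((x + t • EuclideanSpace.single k (1 : ℝ)) j - xC j : ℝ) : ℂ)
        = a j * ((x j - xC j : ℝ) : ℂ) + if j = k then a k * (t : ℂ) else 0 := by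
      intro j
      by_cases h : j = k
      · subst h; simp; ring
      · simp [h]
    simp_rw [this, Finset.sum_add_distrib]
    simp
  simp_rw [hlin]
  have h1 : HasDerivAt (fun t : ℝ => (∑ j, a j * ((x j - xC j : ℝ) : ℂ)) + a k * (t : ℂ))
      (a k) 0 := by
    simpa using ((Complex.ofRealCLM.hasDerivAt (x := (0 : ℝ))).const_mul (a k)).const_add
      (∑ j, a j * ((x j - xC j : ℝ) : ℂ))
  have h2 := (h1.cexp).const_mul b
  refine h2.congr_deriv ?_
  rw [Complex.ofReal_zero, mul_zero, add_zero]
  ring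

lemma iterate_pderiv_const_mul_exp (a : Fin 3 → ℂ) (xC : E3) (b : ℂ) (k : Fin 3) (r : ℕ) :
    (pderiv k)^[r] (fun x : E3 => b * Complex.exp (∑ j, a j * ((x j - xC j : ℝ) : ℂ))) =
      fun x : E3 => (a k ^ r * b) * Complex.exp (∑ j, a j * ((x j - xC j : ℝ) : ℂ)) := by
  induction r with
  | zero => simp
  | succ r ih =>
    rw [Function.iterate_succ_apply', ih, pderiv_const_mul_exp]
    simp only [pow_succ']
    funext x
    ring

lemma taylorCoeff_exp (a : Fin 3 → ℂ) (xC : E3) (i : MIdx) :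
    taylorCoeff xC (fun x : E3 => Complex.exp (∑ j, a j * ((x j - xC j : ℝ) : ℂ))) i =
      (∏ k, a k ^ i k) / (i.fact : ℂ) := by
  have h : (fun x : E3 => Complex.exp (∑ j, a j * ((x j - xC j : ℝ) : ℂ))) =
      fun x : E3 => 1 * Complex.exp (∑ j, a j * ((x j - xC j : ℝ) : ℂ)) := by simp
  rw [taylorCoeff, mderiv, h]
  simp only [iterate_pderiv_const_mul_exp]
  simp [Fin.prod_univ_three, mul_assoc]

/-! ### The scaled frame -/

lemma map_ofReal_transpose_mul_self {P : Matrix (Fin 3) (Fin 3) ℝ}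
    (hP : P ∈ Matrix.orthogonalGroup (Fin 3) ℝ) :
    (P.map (fun t : ℝ => (t : ℂ))).transpose * P.map (fun t : ℝ => (t : ℂ)) = 1 := by
  have h : P.transpose * P = 1 := (Matrix.mem_orthogonalGroup_iff' (Fin 3) ℝ).1 hP
  have := congrArg (fun A : Matrix (Fin 3) (Fin 3) ℝ => A.map Complex.ofRealHom) h
  simp only [Matrix.map_mul, Matrix.map_one _ (map_zero _) (map_one _)] at this
  exact this

/-- Squaring `δ^{-1/2}` gives `δ⁻¹` even for negative `δ`, because the transpose involves no
conjugation. Hence `P D^{-1/2}` maps the unit sphere into the quadric `vᵀ C v = 1`. -/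
lemma transpose_scaledFrame_mul {C : Matrix (Fin 3) (Fin 3) ℂ} {P : Matrix (Fin 3) (Fin 3) ℝ}
    {δ : Fin 3 → ℝ} (h : IsOrthDiag C P δ) :
    (scaledFrame P δ).transpose * C * scaledFrame P δ = 1 := by
  have hP := map_ofReal_transpose_mul_self h.orth
  have hC : C = P.map (fun t : ℝ => (t : ℂ)) * Matrix.diagonal (fun k => (δ k : ℂ)) *
      (P.map (fun t : ℝ => (t : ℂ))).transpose := by
    rw [h.eq]
    change (P * Matrix.diagonal δ * P.transpose).map Complex.ofRealHom = _
    rw [Matrix.map_mul, Matrix.map_mul, Matrix.diagonal_map (map_zero _)]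
    rfl
  rw [hC, scaledFrame]
  set U := P.map (fun t : ℝ => (t : ℂ))
  set D := Matrix.diagonal fun k => ((δ k : ℂ) ^ (-(1 / 2) : ℂ)) with hD
  have hDt : D.transpose = D := Matrix.diagonal_transpose _
  calc (U * D).transpose * (U * Matrix.diagonal (fun k => (δ k : ℂ)) * U.transpose) * (U * D)
      = D * (U.transpose * U) * Matrix.diagonal (fun k => (δ k : ℂ)) * (U.transpose * U) * D := by
        rw [Matrix.transpose_mul, hDt]; simp only [Matrix.mul_assoc]
    _ = 1 := by
        rw [hP, mul_one, mul_one, hD, Matrix.diagonal_mul_diagonal, Matrix.diagonal_mul_diagonal,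
          ← Matrix.diagonal_one]
        congr 1
        funext k
        have hk : (δ k : ℂ) ≠ 0 := Complex.ofReal_ne_zero.2 (h.ne_zero k)
        have h1 : ((δ k : ℂ) ^ (-(1 / 2) : ℂ)) * ((δ k : ℂ) ^ (-(1 / 2) : ℂ)) = (δ k : ℂ)⁻¹ := by
          rw [← Complex.cpow_add _ _ hk, ← Complex.cpow_neg_one]
          norm_num
        rw [mul_right_comm, h1, inv_mul_cancel₀ hk]

/-! ### Counting rows and columns -/

lemma sum_range_two_mul_add_one (n : ℕ) : ∑ l ∈ Finset.range n, (2 * l + 1) = n ^ 2 := by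
  induction n with
  | zero => rfl
  | succ n ih => rw [Finset.sum_range_succ, ih]; ring

lemma card_col (n : ℕ) : Fintype.card (Col n) = (n + 1) ^ 2 := by
  rw [Fintype.card_sigma, ← sum_range_two_mul_add_one,
    ← Fin.sum_univ_eq_sum_range (fun l => 2 * l + 1)]
  refine Finset.sum_congr rfl fun l _ => ?_
  rw [Fintype.card_coe, Int.card_Icc]
  omega

/-- The pairs of natural numbers with sum below `m`. -/
abbrev Triangle (m : ℕ) : Type := (b : Fin m) × Fin (m - b)

lemma two_mul_card_triangle (m : ℕ) : 2 * Fintype.card (Triangle m) = m * (m + 1) := by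
  have h : ∀ m : ℕ, Fintype.card (Triangle m) = ∑ b ∈ Finset.range m, (m - b) := fun m => by
    simp only [Fintype.card_sigma, Fintype.card_fin]
    exact Fin.sum_univ_eq_sum_range (fun b => m - b) m
  rw [h]
  induction m with
  | zero => rfl
  | succ m ih =>
    -- Removing the term `b = 0` and shifting leaves exactly the sum for `m`.
    rw [Finset.sum_range_succ']
    simp only [Nat.add_sub_add_right, mul_add, ih]
    simp only [Nat.sub_zero]
    ring

lemma MIdx.len_eq (i : MIdx) : i.len = i 0 + i 1 + i 2 := Fin.sum_univ_three i

/-- Multi-indices of length at most `n`, by their first component. -/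
def rowEquiv (n : ℕ) : Row n ≃ (a : Fin (n + 1)) × Triangle (n + 1 - a) where
  toFun i :=
    have h := (MIdx.len_eq i.1).symm.trans_le i.2
    ⟨⟨i.1 0, by omega⟩, ⟨i.1 1, by simp only; omega⟩, ⟨i.1 2, by simp only; omega⟩⟩
  invFun t := ⟨![t.1, t.2.1, t.2.2], by
    rw [MIdx.len_eq]
    have := t.1.2; have := t.2.1.2; have := t.2.2.2
    simp; omega⟩
  left_inv i := by
    ext k; fin_cases k <;> rfl
  right_inv t := rfl

/-- Multi-indices of length at most `n` with first component at most one, by that component. -/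
def redRowEquiv (n : ℕ) : RedRow n ≃ (a : Fin 2) × Triangle (n + 1 - a) where
  toFun i :=
    have h := (MIdx.len_eq i.1.1).symm.trans_le i.1.2
    ⟨⟨i.1.1 0, by have := i.2; omega⟩, ⟨i.1.1 1, by simp only; omega⟩,
      ⟨i.1.1 2, by simp only; omega⟩⟩
  invFun t := ⟨⟨![t.1, t.2.1, t.2.2], by
    rw [MIdx.len_eq]
    have := t.1.2; have := t.2.1.2; have := t.2.2.2
    simp; omega⟩, by have := t.1.2; simp; omega⟩
  left_inv i := by
    ext k; fin_cases k <;> rfl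
  right_inv t := rfl

lemma card_row (n : ℕ) : Nat.card (Row n) = (n + 1) * (n + 2) * (n + 3) / 6 := by
  rw [Nat.card_congr (rowEquiv n), Nat.card_eq_fintype_card, Fintype.card_sigma,
    Fin.sum_univ_eq_sum_range (fun a => Fintype.card (Triangle (n + 1 - a)))]
  have h : ∀ m : ℕ, 6 * ∑ a ∈ Finset.range m, Fintype.card (Triangle (m - a)) =
      m * (m + 1) * (m + 2) := by
    intro m
    induction m with
    | zero => rfl
    | succ m ih =>
      rw [Finset.sum_range_succ']
      simp only [Nat.add_sub_add_right, mul_add, ih]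
      have := two_mul_card_triangle (m + 1)
      simp only [Nat.sub_zero]
      nlinarith
  have := h (n + 1)
  rw [show (n + 1) * (n + 2) * (n + 3) = (n + 1) * (n + 1 + 1) * (n + 1 + 2) by ring, ← this]
  omega

lemma card_redRow (n : ℕ) : Nat.card (RedRow n) = (n + 1) ^ 2 := by
  rw [Nat.card_congr (redRowEquiv n), Nat.card_eq_fintype_card, Fintype.card_sigma,
    Fin.sum_univ_two]
  have h1 := two_mul_card_triangle (n + 1)
  have h2 := two_mul_card_triangle n
  -- Two consecutive triangular numbers add up to a square.
  change Fintype.card (Triangle (n + 1)) + Fintype.card (Triangle n) = _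
  nlinarith


/-! ### Linear images of the sphere and the main theorem -/

lemma direction_dotProduct_self (θ φ : ℝ) : direction θ φ ⬝ᵥ direction θ φ = 1 := by
  simp only [direction, dotProduct, Fin.sum_univ_three, Matrix.cons_val]
  linear_combination Real.sin_sq_add_cos_sq θ + Real.sin θ ^ 2 * Real.sin_sq_add_cos_sq φ

lemma directionSwap_dotProduct_self (θ φ : ℝ) :
    directionSwap θ φ ⬝ᵥ directionSwap θ φ = 1 := by
  simp only [directionSwap, dotProduct, Fin.sum_univ_three, Matrix.cons_val]
  linear_combination Real.sin_sq_add_cos_sq θ + Real.sin θ ^ 2 * Real.sin_sq_add_cos_sq φ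

/-- The case of a linear image of directions on the unit sphere. -/
lemma rank_reduced_linear_image {n : ℕ} {d : Col n → Fin 3 → ℝ} {v : Col n → Fin 3 → ℂ}
    {C M : Matrix (Fin 3) (Fin 3) ℂ} {s : ℂ} (hs : s ≠ 0) (hC : C 0 0 ≠ 0)
    (hMC : M.transpose * C * M = 1)
    (hv : ∀ q, v q = s • M.mulVec (fun j => (d q j : ℂ)))
    {θ : Fin (n + 1) → ℝ} (hθ : ∀ l, θ l ∈ Set.Ioo 0 Real.pi) (hθinj : Function.Injective θ)
    {φ : Col n → ℝ} (hφ : ∀ q, φ q ∈ Set.Ico 0 (2 * Real.pi))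
    (hφinj : ∀ l : Fin (n + 1), ∀ m m' : ↥(Finset.Icc (-(l : ℤ)) (l : ℤ)),
      m ≠ m' → φ ⟨l, m⟩ ≠ φ ⟨l, m'⟩)
    (hd : (∀ q, d q = direction (θ q.1) (φ q)) ∨ (∀ q, d q = directionSwap (θ q.1) (φ q)))
    {A : Matrix (Row n) (Col n) ℂ}
    (hA : ∀ i q, A i q = (∏ k, v q k ^ i.1 k) / (i.1.fact : ℂ)) :
    (reduced A).rank = (n + 1) ^ 2 ∧ A.rank = (n + 1) ^ 2 := by
  have hunit : ∀ q, (fun j => (d q j : ℂ)) ⬝ᵥ (fun j => (d q j : ℂ)) = 1 := by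
    intro q
    have h : d q ⬝ᵥ d q = 1 := by
      rcases hd with hd | hd <;> rw [hd q]
      exacts [direction_dotProduct_self _ _, directionSwap_dotProduct_self _ _]
    simp only [dotProduct] at h ⊢
    exact_mod_cast h
  have hquad : ∀ q, v q ⬝ᵥ C.mulVec (v q) = s ^ 2 := by
    intro q
    rw [hv, Matrix.mulVec_smul, smul_dotProduct, dotProduct_smul, Matrix.mulVec_mulVec,
      ← Matrix.vecMul_transpose, ← Matrix.dotProduct_mulVec, Matrix.mulVec_mulVec,
      ← Matrix.mul_assoc, hMC, Matrix.one_mulVec, hunit]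
    simp [sq]
  have hcoord : ∀ j, IsPolyFun v 1 (fun q => (d q j : ℂ)) := by
    intro j
    -- `Mᵀ C` is a left inverse of `M`, so `d = s⁻¹ Mᵀ C v` is linear in `v`.
    have h := (IsPolyFun.linear (v := v) ((M.transpose * C) j)).const_mul s⁻¹
    convert h using 1
    funext q
    change _ = s⁻¹ * (M.transpose * C).mulVec (v q) j
    rw [hv, Matrix.mulVec_smul, Matrix.mulVec_mulVec, hMC, Matrix.one_mulVec, Pi.smul_apply,
      smul_eq_mul, inv_mul_cancel_left₀ hs]
  rw [← card_col]
  rcases hd with hd | hd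
  · exact rank_reduced_monomial hC hquad hθ hθinj hφ hφinj
      (by simpa [hd, direction] using hcoord 0) (by simpa [hd, direction] using hcoord 1)
      (by simpa [hd, direction] using hcoord 2) hA
  · exact rank_reduced_monomial hC hquad hθ hθinj hφ hφinj
      (by simpa [hd, directionSwap] using hcoord 1) (by simpa [hd, directionSwap] using hcoord 0)
      (by simpa [hd, directionSwap] using hcoord 2) hA

end QT

theorem mainTheorem2 (n : ℕ)
    (c : QT.MIdx → QT.E3 → ℂ) (xC : QT.E3) (hc : QT.OperatorHyp c xC)
    (P : Matrix (Fin 3) (Fin 3) ℝ) (δ : Fin 3 → ℝ)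
    (hPD : QT.IsOrthDiag (QT.secondOrderMatrix c xC) P δ)
    (s : ℂ) (hs : s ≠ 0)
    (θ : Fin (n + 1) → ℝ) (hθ : ∀ l, θ l ∈ Set.Ioo 0 Real.pi) (hθinj : Function.Injective θ)
    (φ : QT.Col n → ℝ) (hφ : ∀ q, φ q ∈ Set.Ico 0 (2 * Real.pi))
    (hφinj : ∀ l : Fin (n + 1), ∀ m m' : ↥(Finset.Icc (-(l : ℤ)) (l : ℤ)),
      m ≠ m' → φ ⟨l, m⟩ ≠ φ ⟨l, m'⟩)
    (d : QT.Col n → Fin 3 → ℝ)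
    (hd : (∀ q, d q = QT.direction (θ q.1) (φ q)) ∨
      (∀ q, d q = QT.directionSwap (θ q.1) (φ q))) :
    Nat.card (QT.Row n) = (n + 1) * (n + 2) * (n + 3) / 6 ∧
    Nat.card (QT.RedRow n) = (n + 1) ^ 2 ∧
    Nat.card (QT.Col n) = (n + 1) ^ 2 ∧
    (QT.matR n (fun q => θ q.1) φ).rank = (n + 1) ^ 2 ∧
    (QT.matE n s P δ xC d).rank = (n + 1) ^ 2 ∧
    (QT.reduced (QT.matR n (fun q => θ q.1) φ)).rank = (n + 1) ^ 2 ∧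
    (QT.reduced (QT.matE n s P δ xC d)).rank = (n + 1) ^ 2 := by
  obtain ⟨hE', hE⟩ := QT.rank_reduced_linear_image (A := QT.matE n s P δ xC d) hs
    (by simpa [QT.secondOrderMatrix] using hc.ne_zero) (QT.transpose_scaledFrame_mul hPD)
    (fun _ => rfl) hθ hθinj hφ hφinj hd (fun i q => QT.taylorCoeff_exp _ xC i.1)
  -- The unit sphere itself, with `v = d`. The swapped directions are needed because `i₁` is the
  -- exponent of `sin φ` in the reference matrix.
  obtain ⟨hR', hR⟩ := QT.rank_reduced_linear_image
    (A := QT.matR n (fun q => θ q.1) φ) (C := 1) (M := 1) one_ne_zero (by simp) (by simp)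
    (fun _ => rfl) hθ hθinj hφ hφinj (.inr fun _ => rfl) (fun i q => by
      simp [QT.matR, QT.directionSwap, Fin.prod_univ_three]
      ring)
  exact ⟨QT.card_row n, QT.card_redRow n, by rw [Nat.card_eq_fintype_card, QT.card_col],
    hR, hE, hR', hE'⟩
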